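/- Consider {\sc metric $1$-median}: given an $n$-point metric space $(M,d)$, where $n\ge 1$, whose points are labelled $1,\dots,n$ and whose distances can be accessed only through queries, each revealing $d(x,y)$ for one pair $x,y\in M$, output a point of $M$. A deterministic algorithm chooses each query, and finally its output, as a function of $n$ and of the answers to its earlier queries (adaptive algorithms are allowed, and the algorithms for different $n$ need not be related). For $q\colon\mathbb{Z}^+\to\mathbb{N}$, it is a $q(n)$-query algorithm if for all $n\ge 1$ it makes at most $q(n)$ queries on every $n$-point metric space; for $\beta\colon\mathbb{Z}^+\to\mathbb{R}$, it is $\beta(n)$-approximate if for all $n\ge1$ and every $n$-point metric space $(M,d)$ its output $p$ satisfies $$\sum_{y\in M} d(p,y)\le \beta(n)\cdot\min_{x\in M}\sum_{y\in M} d(x,y).$$ Then {\sc metric $1$-median} has no deterministic $o(n)$-query $O(\log n)$-approximation algorithm: there is no deterministic algorithm that is both a $q(n)$-query algorithm for some $q(n)=o(n)$ and $\beta(n)$-approximate for some $\beta(n)=O(\log n)$. -/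

import Mathlib

open Filter Asymptotics

/-- A deterministic, adaptive query algorithm on the point set `V`: it either halts with an output
point, or queries the distance between two points and continues depending on the answer. -/
inductive QueryTree (V : Type) : Type where
  | output (z : V) : QueryTree V
  | query (a b : V) (next : ℝ → QueryTree V) : QueryTree V

namespace QueryTree

/-- The output when the queries are answered according to `d`. -/
def run {V : Type} (d : V → V → ℝ) : QueryTree V → V
  | output z => z
  | query a b next => run d (next (d a b))

/-- The number of queries made (with repetitions) when they are answered according to `d`. -/
def numQueries {V : Type} (d : V → V → ℝ) : QueryTree V → ℕ
  | output _ => 0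
  | query a b next => numQueries d (next (d a b)) + 1

end QueryTree

/-- `p` is a `β`-approximate 1-median of the finite metric space `M`:
`∑ y, d(p, y) ≤ β * min_q ∑ y, d(q, y)` (the infimum over the finite nonempty `M` is attained). -/
def IsApproxMedian {M : Type} [Fintype M] [MetricSpace M] (β : ℝ) (p : M) : Prop :=
  ∑ y : M, dist p y ≤ β * ⨅ q : M, ∑ y : M, dist q y

/-- A deterministic algorithm for metric 1-median: for every number `n ≥ 1` of points, a query
algorithm on the labels of the `n` points. Different `n` are not required to be treated by
one program, so that every deterministic algorithm in a uniform model is covered too. -/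
abbrev MedianAlgorithm : Type := ∀ n : ℕ+, QueryTree (Fin n)

namespace MedianAlgorithm

/-- On every `n`-point metric space, with its points labelled in any way, the algorithm makes at
most `q n` queries. -/
def QueriesAtMost (A : MedianAlgorithm) (q : ℕ+ → ℕ) : Prop :=
  ∀ (n : ℕ+) (M : Type) [Fintype M] [MetricSpace M] (e : Fin n ≃ M),
    (A n).numQueries (fun a b => dist (e a) (e b)) ≤ q n

/-- On every `n`-point metric space, with its points labelled in any way, the algorithm outputs
a `β n`-approximate 1-median. -/
def IsApproximation (A : MedianAlgorithm) (β : ℕ+ → ℝ) : Prop :=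
  ∀ (n : ℕ+) (M : Type) [Fintype M] [MetricSpace M] (e : Fin n ≃ M),
    IsApproxMedian (β n) (e ((A n).run (fun a b => dist (e a) (e b))))

end MedianAlgorithm

/-! An adversary answers queries with `K` times shortest-walk lengths in a weighted graph. The
`i`-th edge at a point weighs more than `level i`, so the Catalan recursion bounds balls of radius
`r` by `catalan r` (`card_ball_le`). A query adds an edge whose weight is the sum of the potentials
of its ends. Potentials are Lipschitz and never decrease, so later edges create no shortcut between
pairs already answered (`reach_insert`).

After the run, the potential at the output `p` is raised to `L`. Slow ball growth keeps the total
potential at most the total degree plus `4 ^ L`, where the degrees sum to at most twice the number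
of queries (`exists_potential`). Capping the scaled walking distance by `ρ a + ρ b`, with `ρ` the
scaled potential plus one, gives a metric consistent with all answers. In it the optimum is at most
`2 * ∑ ρ`, while `p` costs at least `n * K * L - ∑ ρ`. With `L` of order `log n` and `o(n)` queries,
the ratio exceeds every `O(log n)`. -/

/-! ### Catalan numbers and levels -/

open Finset in
/-- The degree from which on a point has level at least `r`. -/
def threshold (r : ℕ) : ℕ := ∑ i ∈ range r, catalan i

theorem catalan_pos (n : ℕ) : 0 < catalan n := by
  have h := succ_mul_catalan_eq_centralBinom n
  have := Nat.centralBinom_pos n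
  rcases Nat.eq_zero_or_pos (catalan n) with h0 | h0
  · rw [h0] at h; omega
  · exact h0

theorem catalan_le_four_pow (n : ℕ) : catalan n ≤ 4 ^ n := by
  rw [catalan_eq_centralBinom_div]
  refine (Nat.div_le_self _ _).trans ?_
  rw [Nat.centralBinom_eq_two_mul_choose]
  calc (2 * n).choose n ≤ 2 ^ (2 * n) := Nat.choose_le_two_pow _ _
    _ = 4 ^ n := by rw [pow_mul]; norm_num

theorem threshold_succ (r : ℕ) : threshold (r + 1) = threshold r + catalan r :=
  Finset.sum_range_succ _ _

theorem threshold_one : threshold 1 = 1 := by simp [threshold]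

theorem threshold_strictMono : StrictMono threshold :=
  strictMono_nat_of_lt_succ fun r => by
    rw [threshold_succ]; have := catalan_pos r; omega

theorem threshold_le_four_pow (r : ℕ) : threshold r ≤ 4 ^ r := by
  induction r with
  | zero => simp [threshold]
  | succ r ih =>
    rw [threshold_succ, pow_succ]
    have := catalan_le_four_pow r
    omega

/-- The level of a point of degree `k`. -/
def level (k : ℕ) : ℕ := Nat.findGreatest (fun r => threshold r ≤ k) k

theorem le_level_iff {r k : ℕ} : r ≤ level k ↔ threshold r ≤ k := by
  constructor
  · intro h
    have h0 : threshold 0 ≤ k := by simp [threshold]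
    have := Nat.findGreatest_spec (P := fun r => threshold r ≤ k) (Nat.zero_le k) h0
    exact (threshold_strictMono.monotone h).trans this
  · intro h
    exact Nat.le_findGreatest ((threshold_strictMono.le_apply).trans h) h

theorem threshold_level_le (k : ℕ) : threshold (level k) ≤ k := le_level_iff.1 le_rfl

theorem level_lt_iff {r k : ℕ} : level k < r ↔ k < threshold r := by
  rw [← not_le, ← not_le, le_level_iff]

theorem level_mono : Monotone level := fun _ _ h =>
  le_level_iff.2 ((threshold_level_le _).trans h)

theorem one_le_level {k : ℕ} (hk : 1 ≤ k) : 1 ≤ level k :=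
  le_level_iff.2 (by rwa [threshold_one])

theorem level_eq_of_mem_Ico {r k : ℕ} (h : k ∈ Finset.Ico (threshold r) (threshold (r + 1))) :
    level k = r := by
  rw [Finset.mem_Ico] at h
  have h1 := le_level_iff.2 h.1
  have h2 := level_lt_iff.2 h.2
  omega

theorem sum_Ico_threshold (F : ℕ → ℕ) (m : ℕ) :
    ∑ i ∈ Finset.Ico 1 (threshold (m + 1)), F (level i)
      = ∑ r ∈ Finset.Ico 1 (m + 1), catalan r * F r := by
  induction m with
  | zero => simp [threshold_one]
  | succ m ih =>
    have h1 : 1 ≤ threshold (m + 1) := by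
      have := threshold_strictMono.monotone (by omega : 1 ≤ m + 1)
      rwa [threshold_one] at this
    rw [← Finset.sum_Ico_consecutive _ h1 (threshold_strictMono.monotone (Nat.le_succ (m + 1))),
      ih, Finset.sum_Ico_succ_top (by omega : 1 ≤ m + 1)]
    congr 1
    rw [Finset.sum_congr rfl fun i hi => by rw [level_eq_of_mem_Ico hi], Finset.sum_const,
      Nat.card_Ico, Nat.succ_eq_add_one, threshold_succ (m + 1)]
    simp

/-- Exactly `catalan r` indices have level `r`, so this is the Catalan convolution with its `r = 0`
term `catalan m` replaced by `1`. -/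
theorem one_add_sum_Ico_threshold_le (m : ℕ) :
    1 + ∑ i ∈ Finset.Ico 1 (threshold (m + 1)), catalan (m - level i) ≤ catalan (m + 1) := by
  rw [sum_Ico_threshold (fun r => catalan (m - r)), catalan_succ,
    Fin.sum_univ_eq_sum_range (fun i => catalan i * catalan (m - i)) (m + 1),
    Finset.range_eq_Ico, Finset.sum_eq_sum_Ico_succ_bot (by omega : 0 < m + 1)]
  have := catalan_pos m
  simp only [catalan_zero, one_mul, Nat.sub_zero, zero_add]
  omega

/-! ### Weighted walks and Lipschitz hulls -/

/-- There is a walk of length `l` between two points of a graph with weighted edges. -/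
inductive Reach {V : Type} (E : V → V → ℕ → Prop) : V → V → ℕ → Prop where
  | refl (a : V) : Reach E a a 0
  | cons {a b c : V} {w l : ℕ} (h : E a b w) (t : Reach E b c l) : Reach E a c (w + l)

namespace Reach

variable {V : Type} {E : V → V → ℕ → Prop}

theorem trans {a b c : V} {l m : ℕ} (h : Reach E a b l) (h' : Reach E b c m) :
    Reach E a c (l + m) := by
  induction h with
  | refl => simpa using h'
  | cons e _ ih => rw [add_assoc]; exact cons e (ih h')

theorem edge {a b : V} {w : ℕ} (h : E a b w) : Reach E a b w := by
  simpa using cons h (refl b)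

theorem symm (hE : ∀ a b w, E a b w → E b a w) {a b : V} {l : ℕ} (h : Reach E a b l) :
    Reach E b a l := by
  induction h with
  | refl => exact refl _
  | cons e _ ih => rw [add_comm]; exact ih.trans (edge (hE _ _ _ e))

theorem mono {E' : V → V → ℕ → Prop} (hE : ∀ a b w, E a b w → E' a b w) {a b : V} {l : ℕ}
    (h : Reach E a b l) : Reach E' a b l := by
  induction h with
  | refl => exact refl _
  | cons e _ ih => exact cons (hE _ _ _ e) ih

theorem le_add {R : V → ℕ} (hR : ∀ a b w, E a b w → R a ≤ R b + w) {a b : V} {l : ℕ}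
    (h : Reach E a b l) : R a ≤ R b + l := by
  induction h with
  | refl => simp
  | cons e _ ih => have := hR _ _ _ e; omega

end Reach

/-- The least function that dominates `h` and is Lipschitz along the edges of a finite graph. -/
theorem exists_lipschitz_hull {V : Type} [Fintype V] (E : V → V → ℕ → Prop)
    (h : V → ℕ) :
    ∃ R : V → ℕ, (∀ v, h v ≤ R v) ∧ (∀ a b w, E a b w → R a ≤ R b + w) ∧
      (∀ z, ∃ v l, Reach E v z l ∧ R z + l ≤ h v) ∧
      ∀ v z l m, Reach E v z l → m + l ≤ h v → m ≤ R z := by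
  -- The hull is the supremum of `h v - l` over walks of length `l` from `v` to `z`.
  let S : V → Set ℕ := fun z => {m | ∃ v l, Reach E v z l ∧ m + l ≤ h v}
  have bdd : ∀ z, BddAbove (S z) := fun z => ⟨∑ v, h v, by
    rintro m ⟨v, l, -, hm⟩
    have := Finset.single_le_sum (f := h) (fun i _ => Nat.zero_le _) (Finset.mem_univ v)
    omega⟩
  have self : ∀ z, h z ∈ S z := fun z => ⟨z, 0, Reach.refl z, by simp⟩
  have mem : ∀ z, sSup (S z) ∈ S z := fun z => Nat.sSup_mem ⟨_, self z⟩ (bdd z)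
  refine ⟨fun z => sSup (S z), fun z => le_csSup (bdd z) (self z), ?_, mem,
    fun v z l m hr hm => le_csSup (bdd z) ⟨v, l, hr, hm⟩⟩
  intro a b w e
  obtain ⟨v, l, hr, hm⟩ := mem a
  have : sSup (S a) - w ≤ sSup (S b) := by
    rcases le_or_gt (sSup (S a)) w with h' | h'
    · omega
    · exact le_csSup (bdd b) ⟨v, l + w, hr.trans (Reach.edge e), by omega⟩
  show sSup (S a) ≤ sSup (S b) + w
  omega

/-! ### The adversary's answers -/

/-- The knowledge that an adversary has revealed: a graph with weighted edges, whose edges at a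
point are heavier the more queries that point was part of before, and a potential on the points
that bounds distances from above. -/
structure Adversary (V : Type) where
  edge : V → V → ℕ → Prop
  deg : V → ℕ
  nbr : V → ℕ → V
  pot : V → ℕ
  symm : ∀ a b w, edge a b w → edge b a w
  edge_nbr : ∀ a b w, edge a b w → ∃ i, 1 ≤ i ∧ i ≤ deg a ∧ nbr a i = b ∧ level i + 1 ≤ w
  tight : ∀ z, ∃ v l, Reach edge v z l ∧ pot z + l ≤ level (deg v)

namespace Adversary

variable {V : Type}

/-- The distance of `a` and `b` is determined to be `l`. -/
def Settled (s : Adversary V) (a b : V) (l : ℕ) : Prop :=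
  Reach s.edge a b l ∧ (∀ m, Reach s.edge a b m → l ≤ m) ∧ l ≤ s.pot a + s.pot b

/-- The adversary that has revealed nothing. -/
def initial (V : Type) : Adversary V where
  edge _ _ _ := False
  deg _ := 0
  nbr v _ := v
  pot _ := 0
  symm _ _ _ h := h
  edge_nbr _ _ _ h := h.elim
  tight z := ⟨z, 0, Reach.refl z, by simp⟩

theorem pos_of_reach (s : Adversary V) {a b : V} {l : ℕ} (h : Reach s.edge a b l) (hab : a ≠ b) :
    1 ≤ l := by
  cases h with
  | refl => exact absurd rfl hab
  | cons e t =>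
    obtain ⟨i, -, -, -, hi⟩ := s.edge_nbr _ _ _ e
    omega

/-- A walk through a new edge pays the potentials of both ends of that edge; by the Lipschitz bound,
the rest of the walk makes up the difference to the potentials at its own ends. -/
theorem reach_insert {E E' : V → V → ℕ → Prop} {R : V → ℕ}
    (hE' : ∀ a b w, E' a b w → E a b w ∨ w = R a + R b)
    (hR : ∀ a b w, E' a b w → R a ≤ R b + w)
    (hs : ∀ a b w, E' a b w → E' b a w) {a b : V} {l : ℕ} (h : Reach E' a b l) :
    Reach E a b l ∨ R a + R b ≤ l := by
  induction h with
  | refl => exact .inl (Reach.refl _)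
  | @cons a b c w l e t ih =>
    rcases hE' _ _ _ e with e' | rfl
    · rcases ih with ih | ih
      · exact .inl (Reach.cons e' ih)
      · have := hR _ _ _ e
        right; omega
    · have := (t.symm hs).le_add hR
      right; omega

theorem exists_query_of_ne [Fintype V] (s : Adversary V) {x y : V} (hxy : x ≠ y) :
    ∃ (s' : Adversary V) (l : ℕ), (∀ a b m, s.Settled a b m → s'.Settled a b m) ∧
      s'.Settled x y l ∧ ∑ v, s'.deg v ≤ ∑ v, s.deg v + 2 := by
  classical
  let deg' : V → ℕ := fun v => s.deg v + ((if v = x then 1 else 0) + (if v = y then 1 else 0))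
  have hdx : deg' x = s.deg x + 1 := by simp [deg', hxy]
  have hdy : deg' y = s.deg y + 1 := by simp [deg', hxy.symm]
  have hd : ∀ v, s.deg v ≤ deg' v := fun v => Nat.le_add_right _ _
  obtain ⟨R, hR1, hR2, hR3, hR4⟩ := exists_lipschitz_hull s.edge fun v => level (deg' v)
  let E' : V → V → ℕ → Prop := fun a b w => s.edge a b w ∨
    (a = x ∧ b = y ∧ w = R x + R y) ∨ (a = y ∧ b = x ∧ w = R x + R y)
  let nbr' : V → ℕ → V := fun v i => if v = x ∧ i = deg' x then y else
    if v = y ∧ i = deg' y then x else s.nbr v i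
  have hsymm : ∀ a b w, E' a b w → E' b a w := by
    rintro a b w (h | ⟨rfl, rfl, h⟩ | ⟨rfl, rfl, h⟩)
    · exact .inl (s.symm _ _ _ h)
    · exact .inr (.inr ⟨rfl, rfl, h⟩)
    · exact .inr (.inl ⟨rfl, rfl, h⟩)
  have hlip : ∀ a b w, E' a b w → R a ≤ R b + w := by
    rintro a b w (h | ⟨rfl, rfl, h⟩ | ⟨rfl, rfl, h⟩)
    · exact hR2 _ _ _ h
    · omega
    · omega
  have hlx : level (deg' x) ≤ R x := hR1 x
  have hly : level (deg' y) ≤ R y := hR1 y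
  have hlx1 : 1 ≤ level (deg' x) := one_le_level (by omega)
  have hly1 : 1 ≤ level (deg' y) := one_le_level (by omega)
  have hpot : ∀ z, s.pot z ≤ R z := fun z => by
    obtain ⟨v, l, hr, hl⟩ := s.tight z
    exact hR4 v z l _ hr (hl.trans (level_mono (hd v)))
  let s' : Adversary V :=
    { edge := E'
      deg := deg'
      nbr := nbr'
      pot := R
      symm := hsymm
      edge_nbr := by
        rintro a b w (h | ⟨rfl, rfl, h⟩ | ⟨rfl, rfl, h⟩)
        · obtain ⟨i, h1, h2, h3, h4⟩ := s.edge_nbr _ _ _ h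
          refine ⟨i, h1, h2.trans (hd a), ?_, h4⟩
          have hx : ¬ (a = x ∧ i = deg' x) := by rintro ⟨rfl, h⟩; omega
          have hy : ¬ (a = y ∧ i = deg' y) := by rintro ⟨rfl, h⟩; omega
          simp only [nbr', hx, hy, if_false, h3]
        · exact ⟨deg' a, by omega, le_rfl, by simp [nbr'], by omega⟩
        · exact ⟨deg' a, by omega, le_rfl, by simp [nbr', hxy.symm], by omega⟩
      tight := fun z => by
        obtain ⟨v, l, hr, hl⟩ := hR3 z
        exact ⟨v, l, hr.mono fun _ _ _ => .inl, hl⟩ }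
  have hins : ∀ a b l, Reach E' a b l → Reach s.edge a b l ∨ R a + R b ≤ l := fun a b l h =>
    reach_insert (by
      rintro a b w (h | ⟨rfl, rfl, h⟩ | ⟨rfl, rfl, h⟩)
      · exact .inl h
      · exact .inr h
      · exact .inr (by omega)) hlip hsymm h
  have hw : Reach E' x y (R x + R y) := Reach.edge (.inr (.inl ⟨rfl, rfl, rfl⟩))
  -- The answer is the shortest walk, as an old one may be shorter than the new edge.
  have hex : ∃ l, Reach E' x y l := ⟨_, hw⟩
  refine ⟨s', Nat.find hex, ?_, ⟨Nat.find_spec hex, fun m hm => Nat.find_min' hex hm,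
    Nat.find_min' hex hw⟩, ?_⟩
  · rintro a b m ⟨h1, h2, h3⟩
    have ha := hpot a
    have hb := hpot b
    refine ⟨h1.mono fun _ _ _ => .inl, fun l hl => ?_, h3.trans (Nat.add_le_add ha hb)⟩
    rcases hins _ _ _ hl with h | h
    · exact h2 _ h
    · omega
  · show ∑ v, deg' v ≤ _
    simp [deg', Finset.sum_add_distrib]

theorem exists_query [Fintype V] (s : Adversary V) (x y : V) :
    ∃ (s' : Adversary V) (l : ℕ), (∀ a b m, s.Settled a b m → s'.Settled a b m) ∧
      s'.Settled x y l ∧ ∑ v, s'.deg v ≤ ∑ v, s.deg v + 2 := by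
  by_cases hxy : x = y
  · subst hxy
    exact ⟨s, 0, fun _ _ _ h => h, ⟨Reach.refl _, fun _ _ => Nat.zero_le _, Nat.zero_le _⟩,
      Nat.le_add_right _ _⟩
  · exact s.exists_query_of_ne hxy

/-- `s'` and `p` are fixed before `d`, so the metric can be chosen afterwards to be bad for `p`. -/
theorem exists_answers [Fintype V] (K : ℕ) (t : QueryTree V) (s : Adversary V) :
    ∃ (s' : Adversary V) (p : V), (∀ a b m, s.Settled a b m → s'.Settled a b m) ∧
      ∀ d : V → V → ℝ, (∀ a b m, s'.Settled a b m → d a b = (K * m : ℕ)) →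
        t.run d = p ∧ ∑ v, s'.deg v ≤ ∑ v, s.deg v + 2 * t.numQueries d := by
  induction t generalizing s with
  | output z => exact ⟨s, z, fun _ _ _ h => h, fun d _ => ⟨rfl, by simp⟩⟩
  | query a b next ih =>
    obtain ⟨s₁, l, h1, h2, h3⟩ := s.exists_query a b
    obtain ⟨s', p, h4, h5⟩ := ih ((K * l : ℕ) : ℝ) s₁
    refine ⟨s', p, fun _ _ _ h => h4 _ _ _ (h1 _ _ _ h), fun d hd => ?_⟩
    have hab := hd _ _ _ (h4 _ _ _ h2)
    obtain ⟨h6, h7⟩ := h5 d hd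
    simp only [QueryTree.run, QueryTree.numQueries, hab]
    exact ⟨h6, by omega⟩

/-! ### Ball growth and total potential -/

open scoped Classical in
/-- The points at walking distance at most `r` from `v`. -/
noncomputable def ball [Fintype V] (s : Adversary V) (v : V) (r : ℕ) : Finset V :=
  {x | ∃ l ≤ r, Reach s.edge v x l}

theorem mem_ball [Fintype V] {s : Adversary V} {v x : V} {r : ℕ} :
    x ∈ s.ball v r ↔ ∃ l ≤ r, Reach s.edge v x l := by
  classical
  simp [ball]

/-- Splitting a walk at its first edge, the `i`-th at `v`, leaves radius at most `m - level i` out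
of `m + 1`. -/
theorem card_ball_le [Fintype V] (s : Adversary V) (v : V) (r : ℕ) :
    (s.ball v r).card ≤ catalan r := by
  classical
  induction r using Nat.strong_induction_on generalizing v with
  | _ r ih =>
  rcases r with _ | m
  · have : s.ball v 0 ⊆ {v} := fun x hx => by
      obtain ⟨l, hl, h⟩ := mem_ball.1 hx
      by_contra hne
      have := s.pos_of_reach h (by rintro rfl; simp at hne)
      omega
    simpa using Finset.card_le_card this
  · have hsub : s.ball v (m + 1) ⊆ {v} ∪
        (Finset.Ico 1 (threshold (m + 1))).biUnion fun i => s.ball (s.nbr v i) (m - level i) := by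
      intro x hx
      obtain ⟨l, hl, h⟩ := mem_ball.1 hx
      cases h with
      | refl => simp
      | @cons _ b _ w l e t =>
        obtain ⟨i, h1, h2, rfl, h4⟩ := s.edge_nbr _ _ _ e
        refine Finset.mem_union_right _ (Finset.mem_biUnion.2 ⟨i, ?_, mem_ball.2 ⟨l, ?_, t⟩⟩)
        · exact Finset.mem_Ico.2 ⟨h1, level_lt_iff.1 (by omega)⟩
        · omega
    calc _ ≤ _ := Finset.card_le_card hsub
      _ ≤ 1 + _ := (Finset.card_union_le _ _).trans (by rw [Finset.card_singleton])
      _ ≤ 1 + ∑ i ∈ Finset.Ico 1 (threshold (m + 1)), catalan (m - level i) :=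
        Nat.add_le_add_left (Finset.card_biUnion_le.trans
          (Finset.sum_le_sum fun i _ => ih _ (by omega) _)) _
      _ ≤ _ := one_add_sum_Ico_threshold_le m

/-- Double counting: `R z` is at most the number of radii `r` with `l ≤ r < h v`, and for each of
them `z` lies in the ball of radius `r` around `v`. -/
theorem sum_le_sum_threshold [Fintype V] (s : Adversary V) {R h : V → ℕ}
    (hR : ∀ z, ∃ v l, Reach s.edge v z l ∧ R z + l ≤ h v) :
    ∑ z, R z ≤ ∑ v, threshold (h v) := by
  classical
  have hz : ∀ z, R z ≤ ∑ v, ∑ r ∈ Finset.range (h v), if z ∈ s.ball v r then 1 else 0 := by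
    intro z
    obtain ⟨v, l, hr, hl⟩ := hR z
    calc R z ≤ (Finset.Ico l (h v)).card := by rw [Nat.card_Ico]; omega
      _ ≤ ((Finset.range (h v)).filter fun r => z ∈ s.ball v r).card := by
        refine Finset.card_le_card fun r hr' => ?_
        rw [Finset.mem_Ico] at hr'
        exact Finset.mem_filter.2 ⟨Finset.mem_range.2 hr'.2, mem_ball.2 ⟨l, hr'.1, hr⟩⟩
      _ = ∑ r ∈ Finset.range (h v), if z ∈ s.ball v r then 1 else 0 := Finset.card_filter _ _
      _ ≤ _ := Finset.single_le_sum
        (f := fun v => ∑ r ∈ Finset.range (h v), if z ∈ s.ball v r then 1 else 0)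
        (fun _ _ => Nat.zero_le _) (Finset.mem_univ v)
  calc _ ≤ ∑ z, ∑ v, ∑ r ∈ Finset.range (h v), (if z ∈ s.ball v r then 1 else 0) :=
        Finset.sum_le_sum fun z _ => hz z
    _ = ∑ v, ∑ r ∈ Finset.range (h v), (s.ball v r).card := by
        rw [Finset.sum_comm]
        refine Finset.sum_congr rfl fun v _ => ?_
        rw [Finset.sum_comm]
        refine Finset.sum_congr rfl fun r _ => ?_
        simp
    _ ≤ _ := Finset.sum_le_sum fun v _ => Finset.sum_le_sum fun r _ => s.card_ball_le v r

/-- A potential that is large at a prescribed point but has small sum. -/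
theorem exists_potential [Fintype V] (s : Adversary V) (p : V) (L : ℕ) :
    ∃ R : V → ℕ, (∀ v, s.pot v ≤ R v) ∧ (∀ a b w, s.edge a b w → R a ≤ R b + w) ∧ L ≤ R p ∧
      ∑ v, R v ≤ ∑ v, s.deg v + 4 ^ L := by
  classical
  obtain ⟨R, h1, h2, h3, h4⟩ := exists_lipschitz_hull s.edge
    fun v => max (level (s.deg v)) (if v = p then L else 0)
  refine ⟨R, fun z => ?_, h2, ?_, (s.sum_le_sum_threshold h3).trans ?_⟩
  · obtain ⟨v, l, hr, hl⟩ := s.tight z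
    exact h4 v z l _ hr (hl.trans (le_max_left _ _))
  · have := h1 p
    simp only [if_true] at this
    exact (le_max_right _ _).trans this
  · calc _ ≤ ∑ v, (s.deg v + if v = p then 4 ^ L else 0) := by
          refine Finset.sum_le_sum fun v _ => ?_
          rw [threshold_strictMono.monotone.map_max]
          refine max_le ((threshold_level_le _).trans (Nat.le_add_right _ _)) ?_
          split_ifs
          · exact (threshold_le_four_pow L).trans (Nat.le_add_left _ _)
          · simp [threshold]
      _ = _ := by simp [Finset.sum_add_distrib]

/-! ### The final metric -/

/-- The walking distance scaled by `K`, capped by the sum of the values of `ρ`. -/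
noncomputable def cappedDist (s : Adversary V) (K : ℕ) (ρ : V → ℕ) (a b : V) : ℕ :=
  sInf {m | m = ρ a + ρ b ∨ ∃ l, Reach s.edge a b l ∧ m = K * l}

section cappedDist

variable {s : Adversary V} {K : ℕ} {ρ : V → ℕ}

theorem cappedDist_le_add (a b : V) : s.cappedDist K ρ a b ≤ ρ a + ρ b :=
  Nat.sInf_le (.inl rfl)

theorem cappedDist_le_of_reach {a b : V} {l : ℕ} (h : Reach s.edge a b l) :
    s.cappedDist K ρ a b ≤ K * l :=
  Nat.sInf_le (.inr ⟨l, h, rfl⟩)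

theorem cappedDist_cases (a b : V) : s.cappedDist K ρ a b = ρ a + ρ b ∨
    ∃ l, Reach s.edge a b l ∧ s.cappedDist K ρ a b = K * l :=
  Nat.sInf_mem (s := {m | m = ρ a + ρ b ∨ ∃ l, Reach s.edge a b l ∧ m = K * l}) ⟨_, .inl rfl⟩

theorem cappedDist_self (a : V) : s.cappedDist K ρ a a = 0 :=
  Nat.le_zero.1 (cappedDist_le_of_reach (Reach.refl a))

theorem cappedDist_comm (a b : V) : s.cappedDist K ρ a b = s.cappedDist K ρ b a := by
  have : ∀ a b, s.cappedDist K ρ a b ≤ s.cappedDist K ρ b a := fun a b => by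
    rcases cappedDist_cases (s := s) (K := K) (ρ := ρ) b a with h | ⟨l, hl, h⟩
    · rw [h, add_comm]; exact cappedDist_le_add a b
    · rw [h]; exact cappedDist_le_of_reach (hl.symm s.symm)
  exact (this a b).antisymm (this b a)

theorem le_add_cappedDist (hρ : ∀ a b l, Reach s.edge a b l → ρ a ≤ ρ b + K * l) (a b : V) :
    ρ a ≤ ρ b + s.cappedDist K ρ a b := by
  rcases cappedDist_cases (s := s) (K := K) (ρ := ρ) a b with h | ⟨l, hl, h⟩
  · omega
  · rw [h]; exact hρ _ _ _ hl

theorem cappedDist_triangle (hρ : ∀ a b l, Reach s.edge a b l → ρ a ≤ ρ b + K * l) (a b c : V) :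
    s.cappedDist K ρ a c ≤ s.cappedDist K ρ a b + s.cappedDist K ρ b c := by
  have hac := cappedDist_le_add (s := s) (K := K) (ρ := ρ) a c
  rcases cappedDist_cases (s := s) (K := K) (ρ := ρ) a b with h | ⟨l, hl, h⟩
  · have := le_add_cappedDist hρ c b
    rw [cappedDist_comm c b] at this
    omega
  · rcases cappedDist_cases (s := s) (K := K) (ρ := ρ) b c with h' | ⟨l', hl', h'⟩
    · have := le_add_cappedDist hρ a b
      omega
    · rw [h, h', ← mul_add]
      exact cappedDist_le_of_reach (hl.trans hl')

theorem eq_of_cappedDist_eq_zero (hK : 1 ≤ K) (hpos : ∀ v, 1 ≤ ρ v) {a b : V}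
    (h : s.cappedDist K ρ a b = 0) : a = b := by
  by_contra hab
  rcases cappedDist_cases (s := s) (K := K) (ρ := ρ) a b with h' | ⟨l, hl, h'⟩
  · have := hpos a
    omega
  · have h1 := s.pos_of_reach hl hab
    have := Nat.mul_le_mul hK h1
    omega

/-- A settled distance is at most the sum of the potentials, so the cap does not shorten it. -/
theorem cappedDist_of_settled (hρ : ∀ v, K * s.pot v ≤ ρ v) {a b : V} {l : ℕ}
    (h : s.Settled a b l) : s.cappedDist K ρ a b = K * l := by
  obtain ⟨h1, h2, h3⟩ := h
  refine (cappedDist_le_of_reach h1).antisymm ?_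
  rcases cappedDist_cases (s := s) (K := K) (ρ := ρ) a b with h' | ⟨m, hm, h'⟩
  · rw [h']
    have := Nat.mul_le_mul_left K h3
    rw [mul_add] at this
    have := hρ a
    have := hρ b
    omega
  · rw [h']
    exact Nat.mul_le_mul_left K (h2 m hm)

end cappedDist

end Adversary

/-! ### Queries against approximation ratio -/

/-- Every query algorithm on `n` points has a metric on which its output `p` is far from
the other points although the points are close to each other on average. -/
theorem exists_hard_metric {V : Type} [Fintype V] (t : QueryTree V) (K L : ℕ) (hK : 1 ≤ K) :
    ∃ (_ : MetricSpace V) (ρ : V → ℕ), (∀ a b : V, dist a b ≤ ρ a + ρ b) ∧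
      (∀ b : V, (K * L : ℝ) ≤ ρ b + dist (t.run dist) b) ∧
      ∑ v, ρ v ≤ K * (2 * t.numQueries dist + 4 ^ L) + Fintype.card V := by
  obtain ⟨s, p, -, hs⟩ := Adversary.exists_answers K t (.initial V)
  obtain ⟨R, h1, h2, h3, h4⟩ := s.exists_potential p L
  -- The `+ 1` separates points of potential zero; a large `K` makes its cost negligible.
  let ρ : V → ℕ := fun v => K * R v + 1
  have hρ : ∀ a b l, Reach s.edge a b l → ρ a ≤ ρ b + K * l := fun a b l h => by
    have := Nat.mul_le_mul_left K (h.le_add h2)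
    rw [mul_add] at this
    simp only [ρ]
    omega
  let d : V → V → ℝ := fun a b => s.cappedDist K ρ a b
  let inst : MetricSpace V :=
    { dist := d
      dist_self := fun a => by simp [d, Adversary.cappedDist_self]
      dist_comm := fun a b => by simp only [d, Adversary.cappedDist_comm]
      dist_triangle := fun a b c => by
        simpa only [d, ← Nat.cast_add, Nat.cast_le] using Adversary.cappedDist_triangle hρ a b c
      eq_of_dist_eq_zero := fun {a b} h => Adversary.eq_of_cappedDist_eq_zero hK
        (fun v => Nat.le_add_left 1 _) (Nat.cast_eq_zero.1 h) }
  have hd : ∀ a b : V, dist a b = s.cappedDist K ρ a b := fun _ _ => rfl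
  obtain ⟨h5, h6⟩ := hs dist fun a b m h => by
    rw [hd, Adversary.cappedDist_of_settled (fun v => ?_) h]
    exact (Nat.mul_le_mul_left K (h1 v)).trans (Nat.le_add_right _ 1)
  refine ⟨inst, ρ, fun a b => ?_, fun b => ?_, ?_⟩
  · rw [hd]
    exact_mod_cast Adversary.cappedDist_le_add a b
  · rw [h5, hd]
    have := Adversary.le_add_cappedDist hρ p b
    have h7 := Nat.mul_le_mul_left K h3
    have : K * L ≤ ρ b + s.cappedDist K ρ p b := by simp only [ρ] at this ⊢; omega
    exact_mod_cast this
  · have h0 : ∑ v, (Adversary.initial V).deg v = 0 := by simp [Adversary.initial]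
    rw [h0, zero_add] at h6
    have h7 := Nat.mul_le_mul_left K (h4.trans (Nat.add_le_add_right h6 _))
    simpa [ρ, Finset.sum_add_distrib, ← Finset.mul_sum] using h7

/-- The minimum is at most the average over all centres `q`. -/
theorem iInf_sum_dist_le {M : Type} [Fintype M] [Nonempty M] [MetricSpace M] {ρ : M → ℕ}
    (hρ : ∀ a b : M, dist a b ≤ ρ a + ρ b) :
    ⨅ q : M, ∑ y : M, dist q y ≤ 2 * ((∑ v, ρ v : ℕ) : ℝ) := by
  have hn : (0 : ℝ) < Fintype.card M := by exact_mod_cast Fintype.card_pos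
  have h1 : ∑ _q : M, (⨅ q : M, ∑ y : M, dist q y) ≤ ∑ q : M, ∑ y : M, ((ρ q : ℝ) + ρ y) :=
    Finset.sum_le_sum fun q _ => (ciInf_le (Set.finite_range _).bddBelow q).trans
      (Finset.sum_le_sum fun y _ => hρ q y)
  simp only [Finset.sum_const, Finset.card_univ, nsmul_eq_mul, Finset.sum_add_distrib,
    ← Finset.mul_sum] at h1
  push_cast
  nlinarith

/-- The trade-off between the number of queries and the approximation ratio. -/
theorem MedianAlgorithm.queries_approximation_tradeoff {A : MedianAlgorithm} {q : ℕ+ → ℕ}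
    {β : ℕ+ → ℝ} (hq : A.QueriesAtMost q) (hβ : A.IsApproximation β) (n : ℕ+) (K L : ℕ)
    (hK : 1 ≤ K) :
    ((n : ℕ) * (K * L) : ℝ) ≤ (1 + 2 * |β n|) * (K * (2 * q n + 4 ^ L) + (n : ℕ)) := by
  obtain ⟨inst, ρ, h1, h2, h3⟩ := exists_hard_metric (A n) K L hK
  have hq' : (A n).numQueries dist ≤ q n := hq n (Fin n) (Equiv.refl _)
  have hβ' : ∑ y : Fin n, dist ((A n).run dist) y ≤ β n * ⨅ q : Fin n, ∑ y : Fin n, dist q y :=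
    hβ n (Fin n) (Equiv.refl _)
  have : Nonempty (Fin n) := ⟨⟨0, n.pos⟩⟩
  have h4 := iInf_sum_dist_le h1
  have h5 : (0 : ℝ) ≤ ⨅ q : Fin n, ∑ y : Fin n, dist q y :=
    Real.iInf_nonneg fun q => Finset.sum_nonneg fun y _ => dist_nonneg
  have h6 := Finset.sum_le_sum fun (b : Fin n) (_ : b ∈ Finset.univ) => h2 b
  simp only [Finset.sum_const, Finset.card_univ, Fintype.card_fin, nsmul_eq_mul,
    Finset.sum_add_distrib] at h6
  have h7 : ∑ v, ρ v ≤ K * (2 * q n + 4 ^ L) + n := by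
    rw [Fintype.card_fin] at h3
    refine h3.trans ?_
    gcongr
  have h8 : ((∑ v, ρ v : ℕ) : ℝ) ≤ K * (2 * q n + 4 ^ L) + (n : ℕ) := by exact_mod_cast h7
  have h9 : β n * ⨅ q : Fin n, ∑ y : Fin n, dist q y ≤ |β n| * (2 * ((∑ v, ρ v : ℕ) : ℝ)) :=
    (mul_le_mul_of_nonneg_right (le_abs_self _) h5).trans
      (mul_le_mul_of_nonneg_left h4 (abs_nonneg _))
  have h10 := mul_le_mul_of_nonneg_left h8 (by positivity : 0 ≤ 1 + 2 * |β n|)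
  push_cast at h9 h10
  linarith

/-! ### Asymptotics -/

theorem log_le_six_mul_log_sixteen {n : ℕ} (hn : 16 ≤ n) :
    Real.log n ≤ 6 * (Nat.log 16 n : ℕ) := by
  have h1 : 1 ≤ Nat.log 16 n := Nat.log_pos (by norm_num) hn
  have h2 : n < 16 ^ (Nat.log 16 n + 1) := Nat.lt_pow_succ_log_self (by norm_num) n
  have h3 : Real.log n ≤ Real.log ((16 : ℝ) ^ (Nat.log 16 n + 1)) :=
    Real.log_le_log (by positivity) (by exact_mod_cast h2.le)
  have h4 : Real.log 16 ≤ 3 := by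
    have : (16 : ℝ) = 2 ^ 4 := by norm_num
    rw [this, Real.log_pow]
    have := Real.log_two_lt_d9
    norm_num
    linarith
  rw [Real.log_pow] at h3
  push_cast at h3
  have h5 : (1 : ℝ) ≤ (Nat.log 16 n : ℕ) := by exact_mod_cast h1
  nlinarith

theorem mainTheorem5 :
    ¬ ∃ A : MedianAlgorithm,
      (∃ q : ℕ+ → ℕ, A.QueriesAtMost q ∧
        (fun n : ℕ+ => (q n : ℝ)) =o[atTop] (fun n : ℕ+ => ((n : ℕ) : ℝ))) ∧
      (∃ β : ℕ+ → ℝ, A.IsApproximation β ∧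
        β =O[atTop] (fun n : ℕ+ => Real.log ((n : ℕ) : ℝ))) := by
  rintro ⟨A, ⟨q, hq, hqo⟩, β, hβ, hβO⟩
  obtain ⟨C, hC, hβC⟩ := hβO.exists_pos
  -- From `log n ≤ 6 * L` and `1 ≤ L`: `1 + 2 * |β n| ≤ 1 + 12 * C * L ≤ M * L`.
  set M : ℝ := 1 + 12 * C with hM
  have hM0 : 0 < M := by positivity
  obtain ⟨K, hK⟩ := exists_nat_ge (4 * M)
  obtain ⟨N, hN⟩ := exists_nat_ge ((8 * M) ^ 2)
  have hK1 : 1 ≤ K := by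
    have : (1 : ℝ) ≤ K := by linarith
    exact_mod_cast this
  have hK0 : (0 : ℝ) < K := by exact_mod_cast hK1
  have hlarge : ∀ᶠ n : ℕ+ in atTop, N + 16 ≤ (n : ℕ) :=
    eventually_atTop.2 ⟨⟨N + 16, by omega⟩, fun n hn => hn⟩
  obtain ⟨n, h1, h2, h3⟩ := ((hqo.def (by positivity : 0 < 1 / (16 * M))).and
    (hβC.bound.and hlarge)).exists
  -- Base 16 makes `4 ^ L` at most the square root of `n`.
  set L := Nat.log 16 (n : ℕ) with hL
  have hn16 : 16 ≤ (n : ℕ) := by omega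
  have hL1 : (1 : ℝ) ≤ L := by exact_mod_cast Nat.log_pos (by norm_num) hn16
  have hn0 : (0 : ℝ) < (n : ℕ) := by exact_mod_cast n.pos
  have hlog := log_le_six_mul_log_sixteen hn16
  have hlog0 : 0 ≤ Real.log (n : ℕ) := Real.log_natCast_nonneg _
  rw [Real.norm_eq_abs, Real.norm_of_nonneg hlog0] at h2
  rw [Real.norm_of_nonneg (Nat.cast_nonneg _), Real.norm_of_nonneg hn0.le] at h1
  have hq1 : 16 * M * q n ≤ (n : ℕ) := by
    have := mul_le_mul_of_nonneg_left h1 (by positivity : 0 ≤ 16 * M)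
    rwa [← mul_assoc, mul_one_div_cancel (by positivity), one_mul] at this
  have hpow : ((4 : ℝ) ^ L) ^ 2 ≤ (n : ℕ) := by
    have : 16 ^ L ≤ (n : ℕ) := Nat.pow_log_le_self 16 n.pos.ne'
    rw [← pow_mul, mul_comm, pow_mul]
    norm_num
    exact_mod_cast this
  have hNn : (8 * M) ^ 2 ≤ (n : ℕ) := hN.trans (by exact_mod_cast (by omega : N ≤ (n : ℕ)))
  have h4L : 8 * M * 4 ^ L ≤ (n : ℕ) := by
    refine abs_le_of_sq_le_sq' (b := ((n : ℕ) : ℝ)) ?_ hn0.le |>.2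
    rw [mul_pow, sq ((n : ℕ) : ℝ)]
    gcongr
  have htrade := A.queries_approximation_tradeoff hq hβ n K L hK1
  have hfac : 1 + 2 * |β n| ≤ M * L := by
    have := mul_le_mul_of_nonneg_left hlog hC.le
    rw [hM]
    nlinarith
  -- The three terms are at most `n * K / 8`, `n * K / 8` and `n * K / 4`.
  have hS : M * (K * (2 * q n + 4 ^ L) + (n : ℕ)) ≤ (n : ℕ) * K * (1 / 2) := by
    have e1 := mul_le_mul_of_nonneg_left hq1 hK0.le
    have e2 := mul_le_mul_of_nonneg_left h4L hK0.le
    have e3 := mul_le_mul_of_nonneg_left hK hn0.le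
    nlinarith
  have hfinal : ((n : ℕ) * (K * L) : ℝ) ≤ L * ((n : ℕ) * K * (1 / 2)) :=
    calc _ ≤ _ := htrade
      _ ≤ M * L * (K * (2 * q n + 4 ^ L) + (n : ℕ)) :=
        mul_le_mul_of_nonneg_right hfac (by positivity)
      _ = L * (M * (K * (2 * q n + 4 ^ L) + (n : ℕ))) := by ring
      _ ≤ _ := mul_le_mul_of_nonneg_left hS (by positivity)
  have : (0 : ℝ) < (n : ℕ) * K * L := by positivity
  nlinarith
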